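/- Let $\mathcal{A}$ be an additive category and $\mathcal{E}$ an exact structure on $\mathcal{A}$ in the sense of Quillen, that is, a class of kernel–cokernel pairs $(\mu,\pi)$, closed under isomorphisms, such that, calling the first components $\mu$ admissible monomorphisms ($\rightarrowtail$) and the second components $\pi$ admissible epimorphisms ($\twoheadrightarrow$): identities are admissible monomorphisms and admissible epimorphisms; each of the two classes is closed under composition; pushouts of admissible monomorphisms along arbitrary morphisms exist and are admissible monomorphisms; pullbacks of admissible epimorphisms along arbitrary morphisms exist and are admissible epimorphisms. Call an object $I$ injective if every morphism $E\to I$ extends along every admissible monomorphism $E\rightarrowtail F$. Suppose that $\mathcal{A}$ has enough injectives: every object $E$ admits an admissible monomorphism $E\rightarrowtail I$ with $I$ injective. A sequence of morphisms $f_1,f_2,\dots$ with $f_i\colon E_i\to E_{i+1}$ is called an exact sequence of admissible morphisms if each $f_i$ factors as $f_i=\iota_i\pi_i$ with $\pi_i$ an admissible epimorphism and $\iota_i$ an admissible monomorphism such that $(\iota_i,\pi_{i+1})\in\mathcal{E}$ for all consecutive $f_i,f_{i+1}$. Then, for every integer $n\ge 1$ and every object $E$ of $\mathcal{A}$, the following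 are equivalent. (i) Whenever $$E\rightarrowtail I^0\to\cdots\to I^{n-1}\twoheadrightarrow F$$ is an exact sequence of admissible morphisms, beginning with an admissible monomorphism and ending with an admissible epimorphism, in which $I^0,\dots,I^{n-1}$ are injective, the object $F$ is injective. (ii) There is an exact sequence of admissible morphisms $$E\rightarrowtail I^0\to\cdots\to I^{n-1}\twoheadrightarrow I^n,$$ beginning with an admissible monomorphism and ending with an admissible epimorphism, in which $I^0,\dots,I^n$ are injective. -/

import Mathlib

open CategoryTheory CategoryTheory.Limits

universe v u

namespace ExactCat

variable {C : Type u} [Category.{v} C] [Preadditive C]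

/-- The composable pair `K ⟶ E ⟶ Q` given by `μ` and `π` belongs to the class `Ex`
(classes of composable pairs with zero composition are encoded as object properties of
`ShortComplex C`). -/
def InClass (Ex : ObjectProperty (ShortComplex C)) {K E Q : C} (μ : K ⟶ E) (π : E ⟶ Q) : Prop :=
  ∃ w : μ ≫ π = 0, Ex (ShortComplex.mk μ π w)

/-- The class of admissible monomorphisms: first components of pairs in `Ex`. -/
def admissibleMono (Ex : ObjectProperty (ShortComplex C)) : MorphismProperty C :=
  fun _ E μ => ∃ (Q : C) (π : E ⟶ Q), InClass Ex μ π

/-- The class of admissible epimorphisms: second components of pairs in `Ex`. -/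
def admissibleEpi (Ex : ObjectProperty (ShortComplex C)) : MorphismProperty C :=
  fun E _ π => ∃ (K : C) (μ : K ⟶ E), InClass Ex μ π

/-- `T` is a kernel-cokernel pair: `T.f` is a kernel of `T.g` and `T.g` is a cokernel of `T.f`. -/
def IsKernelCokernelPair (T : ShortComplex C) : Prop :=
  Nonempty (IsLimit (KernelFork.ofι T.f T.zero)) ∧
    Nonempty (IsColimit (CokernelCofork.ofπ T.g T.zero))

/-- `Ex` is an exact structure (in the sense of Quillen): a class of kernel-cokernel pairs, closed
under isomorphisms, satisfying [E0], [E0ᵒᵖ], [E1], [E1ᵒᵖ], [E2], [E2ᵒᵖ]. -/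
structure IsExactStructure (Ex : ObjectProperty (ShortComplex C)) : Prop where
  isKernelCokernelPair : ∀ T : ShortComplex C, Ex T → IsKernelCokernelPair T
  of_iso : ∀ {T T' : ShortComplex C}, (T ≅ T') → Ex T → Ex T'
  id_mono : ∀ E : C, admissibleMono Ex (𝟙 E)
  id_epi : ∀ E : C, admissibleEpi Ex (𝟙 E)
  comp_mono : ∀ {E F G : C} (f : E ⟶ F) (g : F ⟶ G),
    admissibleMono Ex f → admissibleMono Ex g → admissibleMono Ex (f ≫ g)
  comp_epi : ∀ {E F G : C} (f : E ⟶ F) (g : F ⟶ G),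
    admissibleEpi Ex f → admissibleEpi Ex g → admissibleEpi Ex (f ≫ g)
  pushout_mono : ∀ {E F E' : C} (f : E ⟶ F) (g : E ⟶ E'), admissibleMono Ex f →
    ∃ (F' : C) (g' : F ⟶ F') (f' : E' ⟶ F'), IsPushout f g g' f' ∧ admissibleMono Ex f'
  pullback_epi : ∀ {E F F' : C} (f : E ⟶ F) (g : F' ⟶ F), admissibleEpi Ex f →
    ∃ (E' : C) (f' : E' ⟶ F') (g' : E' ⟶ E), IsPullback f' g' g f ∧ admissibleEpi Ex f'

/-- `I` is `M`-injective: every morphism to `I` extends along every morphism in `M`. -/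
def IsInjectiveFor (M : MorphismProperty C) (I : C) : Prop :=
  ∀ {E F : C} (μ : E ⟶ F), M μ → ∀ f : E ⟶ I, ∃ g : F ⟶ I, μ ≫ g = f

/-- Every object is the source of a morphism in `M` with `M`-injective target. -/
def HasEnoughInjectivesFor (M : MorphismProperty C) : Prop :=
  ∀ E : C, ∃ I : C, IsInjectiveFor M I ∧ ∃ μ : E ⟶ I, M μ

/-- The finite sequence `X 0 ⟶ X 1 ⟶ ⋯ ⟶ X (n + 1)` with maps `d` is an exact sequence of admissible
morphisms: each `d i` factors as an admissible epimorphism `π i` followed by an admissible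
monomorphism `ι i`, and the pair `(ι i, π (i + 1))` is in `Ex` at each of the intermediate objects
`X 1, …, X n`. -/
def IsExactSequence (Ex : ObjectProperty (ShortComplex C)) {n : ℕ} (X : Fin (n + 2) → C)
    (d : ∀ i : Fin (n + 1), X i.castSucc ⟶ X i.succ) : Prop :=
  ∃ (G : Fin (n + 1) → C) (π : ∀ i : Fin (n + 1), X i.castSucc ⟶ G i)
    (ι : ∀ i : Fin (n + 1), G i ⟶ X i.succ),
    (∀ i, admissibleEpi Ex (π i)) ∧ (∀ i, admissibleMono Ex (ι i)) ∧
    (∀ i, d i = π i ≫ ι i) ∧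
    ∀ i : Fin n, InClass Ex (ι i.castSucc) (π i.succ)

/-- `X 0 ↣ X 1 ⟶ ⋯ ⟶ X n ↠ X (n + 1)` is an exact sequence of admissible morphisms whose first
morphism is an admissible monomorphism and whose last morphism is an admissible epimorphism. -/
def IsBoundedExactSequence (Ex : ObjectProperty (ShortComplex C)) {n : ℕ} (X : Fin (n + 2) → C)
    (d : ∀ i : Fin (n + 1), X i.castSucc ⟶ X i.succ) : Prop :=
  IsExactSequence Ex X d ∧ admissibleMono Ex (d 0) ∧ admissibleEpi Ex (d (Fin.last n))

end ExactCat

/-!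
Cut a bounded exact sequence into its admissible short exact pieces `Zᵢ ↣ Iᵢ ↠ Zᵢ₊₁`. When the `Iᵢ`
are injective, the cosyzygy `Zᵢ₊₁` is determined by `Zᵢ` up to maps that factor through an
injective, so the last terms of two such resolutions of `E` are retracts of each other modulo such
maps. A retract of an injective object in this weak sense is still injective, hence injectivity of
the last term does not depend on the resolution; enough injectives provide at least one.
-/

namespace ExactCat

section Injective

variable {C : Type u} [Category.{v} C] {M : MorphismProperty C}

theorem IsInjectiveFor.of_isZero {I : C} (hI : IsZero I) : IsInjectiveFor M I :=
  fun {_ F} _ _ _ => ⟨hI.from_ F, hI.eq_of_tgt _ _⟩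

theorem IsInjectiveFor.of_retract {I I' : C} (hI' : IsInjectiveFor M I') (r : Retract I I') :
    IsInjectiveFor M I := by
  intro A B μ hμ f
  obtain ⟨g, hg⟩ := hI' μ hμ (f ≫ r.i)
  exact ⟨g ≫ r.r, by simp [reassoc_of% hg]⟩

end Injective

section StableRetract

variable {C : Type u} [Category.{v} C] [Preadditive C] {M : MorphismProperty C}

/-- `E` is a retract of `E'` in the stable category, where morphisms factoring through an
`M`-injective object vanish. The retraction identity is recorded in `C`, with its correction term
`s ≫ t`, so that the quotient category need not be formed. -/
def IsStableRetract (M : MorphismProperty C) (E E' : C) : Prop :=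
  ∃ (a : E ⟶ E') (b : E' ⟶ E) (J : C) (s : E ⟶ J) (t : J ⟶ E),
    IsInjectiveFor M J ∧ a ≫ b + s ≫ t = 𝟙 E

theorem IsStableRetract.of_retract [HasZeroObject C] {E E' : C} (r : Retract E E') :
    IsStableRetract M E E' := by
  obtain ⟨J, hJ⟩ := HasZeroObject.zero (C := C)
  exact ⟨r.i, r.r, J, 0, 0, IsInjectiveFor.of_isZero hJ, by simp⟩

theorem IsStableRetract.isInjectiveFor {E E' : C} (h : IsStableRetract M E E')
    (hE' : IsInjectiveFor M E') : IsInjectiveFor M E := by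
  obtain ⟨a, b, J, s, t, hJ, hid⟩ := h
  intro A B μ hμ f
  obtain ⟨g₁, hg₁⟩ := hE' μ hμ (f ≫ a)
  obtain ⟨g₂, hg₂⟩ := hJ μ hμ (f ≫ s)
  refine ⟨g₁ ≫ b + g₂ ≫ t, ?_⟩
  calc μ ≫ (g₁ ≫ b + g₂ ≫ t) = f ≫ (a ≫ b + s ≫ t) := by
        simp only [Preadditive.comp_add, reassoc_of% hg₁, reassoc_of% hg₂]
    _ = f := by rw [hid, Category.comp_id]

theorem exists_shortComplexHom_of_isInjectiveFor {S S' : ShortComplex C}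
    (hS : IsColimit (CokernelCofork.ofπ S.g S.zero)) (hf : M S.f) (hI' : IsInjectiveFor M S'.X₂)
    (a : S.X₁ ⟶ S'.X₁) : ∃ φ : S ⟶ S', φ.τ₁ = a := by
  obtain ⟨α, hα⟩ := hI' S.f hf (a ≫ S'.f)
  obtain ⟨a', ha' : S.g ≫ a' = α ≫ S'.g⟩ := CokernelCofork.IsColimit.desc' hS (α ≫ S'.g)
    (by rw [reassoc_of% hα, S'.zero, comp_zero])
  exact ⟨⟨a, α, a', hα.symm, ha'.symm⟩, rfl⟩

theorem IsStableRetract.cosyzygy {S S' : ShortComplex C}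
    (hS : IsColimit (CokernelCofork.ofπ S.g S.zero))
    (hS' : IsColimit (CokernelCofork.ofπ S'.g S'.zero)) (hf : M S.f) (hf' : M S'.f)
    (hI : IsInjectiveFor M S.X₂) (hI' : IsInjectiveFor M S'.X₂)
    (h : IsStableRetract M S.X₁ S'.X₁) : IsStableRetract M S.X₃ S'.X₃ := by
  obtain ⟨a, b, J, s, t, hJ, hid⟩ := h
  obtain ⟨φ, rfl⟩ := exists_shortComplexHom_of_isInjectiveFor hS hf hI' a
  obtain ⟨ψ, rfl⟩ := exists_shortComplexHom_of_isInjectiveFor hS' hf' hI b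
  obtain ⟨σ, hσ⟩ := hJ S.f hf s
  -- The defect of the retraction on `S.X₂` vanishes on `S.X₁`, so it descends to `S.X₃`; the
  -- correction term for `S.X₃` therefore factors through the injective object `S.X₂`.
  have hdefect : S.f ≫ (𝟙 S.X₂ - φ.τ₂ ≫ ψ.τ₂ - σ ≫ t ≫ S.f) = 0 := by
    have hid_f : S.f ≫ φ.τ₂ ≫ ψ.τ₂ + s ≫ t ≫ S.f = S.f := by
      simpa [φ.comm₁₂_assoc, ψ.comm₁₂] using congr($hid ≫ S.f)
    simp only [Preadditive.comp_sub, Category.comp_id, reassoc_of% hσ]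
    rw [sub_sub, hid_f, sub_self]
  obtain ⟨k, hk : S.g ≫ k = _⟩ := CokernelCofork.IsColimit.desc' hS _ hdefect
  have : Epi S.g := epi_of_isColimit_cofork hS
  refine ⟨φ.τ₃, ψ.τ₃, S.X₂, k, S.g, hI, ?_⟩
  rw [← cancel_epi S.g, Preadditive.comp_add, reassoc_of% hk, ← φ.comm₂₃_assoc, ← ψ.comm₂₃]
  simp [Preadditive.sub_comp]

end StableRetract

variable {C : Type u} [Category.{v} C] [Preadditive C] {Ex : ObjectProperty (ShortComplex C)}

theorem strongMono_of_admissibleMono (hEx : Ex ≤ IsKernelCokernelPair) {K E : C} {μ : K ⟶ E}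
    (hμ : admissibleMono Ex μ) : StrongMono μ := by
  obtain ⟨Q, π, w, h⟩ := hμ
  obtain ⟨⟨hker⟩, -⟩ := hEx _ h
  have : NormalMono μ := ⟨Q, π, w, hker⟩
  infer_instance

theorem strongEpi_of_admissibleEpi (hEx : Ex ≤ IsKernelCokernelPair) {E Q : C} {π : E ⟶ Q}
    (hπ : admissibleEpi Ex π) : StrongEpi π := by
  obtain ⟨K, μ, w, h⟩ := hπ
  obtain ⟨-, ⟨hcoker⟩⟩ := hEx _ h
  have : NormalEpi π := ⟨K, μ, w, hcoker⟩
  infer_instance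

/-- `Z 0, …, Z n` are successive cosyzygies with middle terms `I 0, …, I (n - 1)`: there are pairs
`Z i ↣ I i ↠ Z (i + 1)` in `Ex`. Splicing them gives a bounded exact sequence
`Z 0 ↣ I 0 ⟶ ⋯ ⟶ I (n - 1) ↠ Z n`. -/
def IsCosyzygyChain (Ex : ObjectProperty (ShortComplex C)) {n : ℕ} (Z : Fin (n + 1) → C)
    (I : Fin n → C) : Prop :=
  ∀ i : Fin n, ∃ (j : Z i.castSucc ⟶ I i) (q : I i ⟶ Z i.succ), InClass Ex j q

theorem exists_isCosyzygyChain (hinj : HasEnoughInjectivesFor (admissibleMono Ex)) (n : ℕ) (E : C) :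
    ∃ (Z : Fin (n + 1) → C) (I : Fin n → C), Z 0 = E ∧ IsCosyzygyChain Ex Z I ∧
      ∀ i, IsInjectiveFor (admissibleMono Ex) (I i) := by
  choose J hJ j Q q hjq using hinj
  let Z (k : ℕ) : C := Nat.rec E (fun _ => Q) k
  exact ⟨fun i => Z i, fun i => J (Z i), rfl, fun i => ⟨j (Z i), q (Z i), hjq (Z i)⟩,
    fun i => hJ (Z i)⟩

theorem IsCosyzygyChain.exists_isBoundedExactSequence (hEx : IsExactStructure Ex) {n : ℕ}
    {Z : Fin (n + 1) → C} {I : Fin n → C} (h : IsCosyzygyChain Ex Z I) :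
    ∃ (X : Fin (n + 2) → C) (d : ∀ i : Fin (n + 1), X i.castSucc ⟶ X i.succ),
      X 0 = Z 0 ∧ IsBoundedExactSequence Ex X d ∧ ∀ m : Fin n, X m.castSucc.succ = I m := by
  choose j q hjq using h
  -- The last cosyzygy is its own target, so that `X n ⟶ X (n + 1)` is an admissible
  -- epimorphism.
  let A : ∀ i : Fin (n + 1), Σ W : C, Z i ⟶ W :=
    Fin.lastCases ⟨Z (Fin.last n), 𝟙 _⟩ fun i => ⟨I i, j i⟩
  have hA_last : A (Fin.last n) = ⟨_, 𝟙 _⟩ := Fin.lastCases_last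
  have hA_castSucc (i : Fin n) : A i.castSucc = ⟨I i, j i⟩ := Fin.lastCases_castSucc i
  have hι (i : Fin (n + 1)) : admissibleMono Ex (A i).2 := by
    cases i using Fin.lastCases with
    | last => rw [hA_last]; exact hEx.id_mono _
    | cast i => rw [hA_castSucc]; exact ⟨_, _, hjq i⟩
  have hpair (i : Fin n) : ∃ p : (A i.castSucc).1 ⟶ Z i.succ, InClass Ex (A i.castSucc).2 p := by
    rw [hA_castSucc]; exact ⟨q i, hjq i⟩
  choose p hp using hpair
  let X : Fin (n + 2) → C := Fin.cons (Z 0) fun i => (A i).1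
  let π : ∀ i : Fin (n + 1), X i.castSucc ⟶ Z i := Fin.cases (𝟙 (Z 0)) p
  have hπ (i : Fin (n + 1)) : admissibleEpi Ex (π i) := by
    cases i using Fin.cases with
    | zero => exact hEx.id_epi (Z 0)
    | succ i => exact ⟨_, _, hp i⟩
  have hι_last : admissibleEpi Ex (A (Fin.last n)).2 := by rw [hA_last]; exact hEx.id_epi _
  exact ⟨X, fun i => π i ≫ (A i).2, rfl,
    ⟨⟨Z, π, fun i => (A i).2, hπ, hι, fun _ => rfl, hp⟩,
      hEx.comp_mono _ _ (hEx.id_mono _) (hι 0), hEx.comp_epi _ _ (hπ _) hι_last⟩,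
    fun m => congrArg Sigma.fst (hA_castSucc m)⟩

theorem IsBoundedExactSequence.exists_isCosyzygyChain (hEx : Ex ≤ IsKernelCokernelPair) {n : ℕ}
    {X : Fin (n + 2) → C} {d : ∀ i : Fin (n + 1), X i.castSucc ⟶ X i.succ}
    (h : IsBoundedExactSequence Ex X d) :
    ∃ Z : Fin (n + 1) → C, IsCosyzygyChain Ex Z (fun m => X m.castSucc.succ) ∧
      Nonempty (X 0 ≅ Z 0) ∧ Nonempty (X (Fin.last (n + 1)) ≅ Z (Fin.last n)) := by
  obtain ⟨⟨Z, π, ι, hπ, hι, hd, hpair⟩, hd_first, hd_last⟩ := h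
  have := strongEpi_of_admissibleEpi hEx (hπ 0)
  have := strongMono_of_admissibleMono hEx (hι (Fin.last n))
  rw [hd] at hd_first hd_last
  have := (strongMono_of_admissibleMono hEx hd_first).mono
  have := (strongEpi_of_admissibleEpi hEx hd_last).epi
  have : Mono (π 0) := mono_of_mono (π 0) (ι 0)
  have : Epi (ι (Fin.last n)) := epi_of_epi (π _) (ι _)
  have : IsIso (π 0) := isIso_of_mono_of_strongEpi _
  have : IsIso (ι (Fin.last n)) := isIso_of_epi_of_strongMono _
  have e₀ := asIso (π 0)
  have e₁ := asIso (ι (Fin.last n))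
  exact ⟨Z, fun i => ⟨_, _, hpair i⟩, ⟨e₀⟩, ⟨e₁.symm⟩⟩

theorem IsCosyzygyChain.isStableRetract (hEx : Ex ≤ IsKernelCokernelPair) {n : ℕ}
    {Z Z' : Fin (n + 1) → C} {I I' : Fin n → C} (h : IsCosyzygyChain Ex Z I)
    (h' : IsCosyzygyChain Ex Z' I') (hI : ∀ i, IsInjectiveFor (admissibleMono Ex) (I i))
    (hI' : ∀ i, IsInjectiveFor (admissibleMono Ex) (I' i))
    (h₀ : IsStableRetract (admissibleMono Ex) (Z 0) (Z' 0)) (i : Fin (n + 1)) :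
    IsStableRetract (admissibleMono Ex) (Z i) (Z' i) := by
  induction i using Fin.induction with
  | zero => exact h₀
  | succ i ih =>
    obtain ⟨j, q, w, hjq⟩ := h i
    obtain ⟨j', q', w', hjq'⟩ := h' i
    obtain ⟨-, ⟨hcoker⟩⟩ := hEx _ hjq
    obtain ⟨-, ⟨hcoker'⟩⟩ := hEx _ hjq'
    exact ih.cosyzygy hcoker hcoker' ⟨_, _, w, hjq⟩ ⟨_, _, w', hjq'⟩ (hI i) (hI' i)

theorem IsBoundedExactSequence.isInjectiveFor_last [HasZeroObject C]
    (hEx : Ex ≤ IsKernelCokernelPair) {n : ℕ} {X X' : Fin (n + 2) → C}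
    {d : ∀ i : Fin (n + 1), X i.castSucc ⟶ X i.succ}
    {d' : ∀ i : Fin (n + 1), X' i.castSucc ⟶ X' i.succ}
    (h : IsBoundedExactSequence Ex X d) (h' : IsBoundedExactSequence Ex X' d') (e : X 0 ≅ X' 0)
    (hX : ∀ m : Fin n, IsInjectiveFor (admissibleMono Ex) (X m.castSucc.succ))
    (hX' : ∀ m : Fin (n + 1), IsInjectiveFor (admissibleMono Ex) (X' m.succ)) :
    IsInjectiveFor (admissibleMono Ex) (X (Fin.last (n + 1))) := by
  obtain ⟨Z, hZ, ⟨e₀⟩, ⟨e₁⟩⟩ := h.exists_isCosyzygyChain hEx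
  obtain ⟨Z', hZ', ⟨e₀'⟩, ⟨e₁'⟩⟩ := h'.exists_isCosyzygyChain hEx
  have hretract : IsStableRetract (admissibleMono Ex) (Z (Fin.last n)) (Z' (Fin.last n)) :=
    hZ.isStableRetract hEx hZ' hX (fun m => hX' m.castSucc)
      (.of_retract (e₀.symm ≪≫ e ≪≫ e₀').retract) _
  have hZ'_last : IsInjectiveFor (admissibleMono Ex) (Z' (Fin.last n)) :=
    IsInjectiveFor.of_retract (hX' (Fin.last n)) e₁'.symm.retract
  have hZ_last : IsInjectiveFor (admissibleMono Ex) (Z (Fin.last n)) :=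
    hretract.isInjectiveFor hZ'_last
  exact fun {_ _} => hZ_last.of_retract e₁.retract

end ExactCat

theorem mainTheorem10 {C : Type u} [Category.{v} C] [Preadditive C] [HasZeroObject C]
    [HasBinaryBiproducts C] (Ex : ObjectProperty (ShortComplex C))
    (hEx : ExactCat.IsExactStructure Ex)
    (hinj : ExactCat.HasEnoughInjectivesFor (ExactCat.admissibleMono Ex))
    (n : ℕ) (hn : 1 ≤ n) (E : C) :
    -- every `E ↣ I⁰ ⟶ ⋯ ⟶ Iⁿ⁻¹ ↠ F` with injective `Iᵐ = X (m + 1)` has `F = X (n + 1)` injective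
    (∀ (X : Fin (n + 2) → C) (d : ∀ i : Fin (n + 1), X i.castSucc ⟶ X i.succ),
      X 0 = E → ExactCat.IsBoundedExactSequence Ex X d →
      (∀ m : Fin n, ExactCat.IsInjectiveFor (ExactCat.admissibleMono Ex) (X m.castSucc.succ)) →
      ExactCat.IsInjectiveFor (ExactCat.admissibleMono Ex) (X (Fin.last (n + 1)))) ↔
    -- there is `E ↣ I⁰ ⟶ ⋯ ⟶ Iⁿ⁻¹ ↠ Iⁿ` with all `Iᵐ = X (m + 1)` injective
    (∃ (X : Fin (n + 2) → C) (d : ∀ i : Fin (n + 1), X i.castSucc ⟶ X i.succ),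
      X 0 = E ∧ ExactCat.IsBoundedExactSequence Ex X d ∧
      ∀ m : Fin (n + 1), ExactCat.IsInjectiveFor (ExactCat.admissibleMono Ex) (X m.succ)) := by
  constructor
  · intro h
    obtain ⟨Z, I, rfl, hZ, hI⟩ := ExactCat.exists_isCosyzygyChain hinj n E
    obtain ⟨X, d, hX₀, hX, hXI⟩ := hZ.exists_isBoundedExactSequence hEx
    have hmid (m : Fin n) : ExactCat.IsInjectiveFor (ExactCat.admissibleMono Ex)
        (X m.castSucc.succ) := hXI m ▸ hI m
    exact ⟨X, d, hX₀, hX, Fin.lastCases (h X d hX₀ hX hmid) hmid⟩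
  · rintro ⟨X', d', hX₀', hX', hI'⟩ X d hX₀ hX hI
    exact hX.isInjectiveFor_last hEx.isKernelCokernelPair hX' (eqToIso (hX₀.trans hX₀'.symm)) hI hI'
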